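/- Let $T=(V,E)$ be a tree with $n$ vertices and maximum degree at most $k$. The labels $l_1,\dots,l_n$ have true locations given by a bijection $M_T:\{l_1,\dots,l_n\}\to V$ and hypothesized locations given by an arbitrary map $M_H:\{l_1,\dots,l_n\}\to V$; both change with time, and both start from arbitrary configurations. In every time unit the tracking algorithm makes one step: starting with $l_1$, it asks an oracle about the label $l_i$ that it is currently processing, at the vertex $u=M_H(l_i)$. If $M_T(l_i)=u$, the oracle answers null and the algorithm passes on to the next label, cyclically ($l_1$ follows $l_n$). Otherwise the oracle returns the first edge $(u,v)$ of the path in $T$ from $u$ to $M_T(l_i)$, and the algorithm sets $M_H(l_i):=v$. The evolver is uniformly random and the algorithm has speedup factor $2$: at the end of every second time unit an edge of $T$ is chosen uniformly at random, independently of all earlier choices, and the true labels at its two endpoints are swapped. For $v\in V$ let $L_{\mathcal H,v}(t)$ be the set of labels $l$ with $M_H(l)=v$ after $t$ time units. Then, after a long enough time, every vertex of the hypothesis tree holds at most $O(\sqrt n)$ labels with high probability. Precisely: for every $k$ there are constants $C,c>0$ and a function $t_0:\mathbb N\to\mathbb N$, depending only on $k$, such that for all such $T$ with $n$ vertices, all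 initial labelings $M_T$, $M_H$, and every time $t\ge t_0(n)$, $$\Pr\Bigl[\,|L_{\mathcal H,v}(t)|\le C\sqrt n\ \text{ for all } v\in V\Bigr]\ \ge\ 1-e^{-c\sqrt n}.$$ -/

import Mathlib

open MeasureTheory ProbabilityTheory

namespace EvolvingTree

/-- A configuration of the whole system on the vertex set `V`, with labels `0, …, n - 1`:
the true labeling `M_T` (a bijection), the hypothesized labeling `M_H` (any map),
and the label that the tracking algorithm is currently processing. -/
structure State (n : ℕ) (V : Type*) where
  trueLoc : Fin n ≃ V
  hypLoc : Fin n → V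
  current : Fin n

variable {n : ℕ} {V : Type*} [DecidableEq V]

/-- The oracle for the target vertex `w` (where a label truly resides), probed at the vertex `u`:
`none` if `u = w`, and otherwise the edge `(u, v)` at `u` that begins the unique path from `u`
to `w` in the tree `T`; the edge is given by its other endpoint `v`. -/
noncomputable def oracleTo {T : SimpleGraph V} (hT : T.IsTree) (w u : V) : Option V :=
  if u = w then none else some (hT.existsUnique_path u w).choose.snd

/-- The answer of the oracle to the query `(l, u)` in the configuration `s`. -/
noncomputable def oracle {T : SimpleGraph V} (hT : T.IsTree) (s : State n V) (l : Fin n) (u : V) :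
    Option V :=
  oracleTo hT (s.trueLoc l) u

/-- One step of the tracking algorithm: query the current label at its hypothesized location.
If the answer is null, go on to the next label (cyclically; a full cycle is an iteration);
otherwise move the hypothesis of the current label along the returned edge. -/
noncomputable def algStep {T : SimpleGraph V} (hT : T.IsTree) (s : State n V) : State n V :=
  match oracle hT s s.current (s.hypLoc s.current) with
  | none => { s with current := finRotate n s.current }
  | some v => { s with hypLoc := Function.update s.hypLoc s.current v }

/-- The transposition of the two endpoints of an unordered pair of vertices. -/
def swapEnds (e : Sym2 V) : Equiv.Perm V :=
  Sym2.lift ⟨fun a b => Equiv.swap a b, fun a b => Equiv.swap_comm a b⟩ e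

/-- One step of the evolver: exchange the true labels at the two endpoints of `e`. -/
def evolverStep (e : Sym2 V) (s : State n V) : State n V :=
  { s with trueLoc := s.trueLoc.trans (swapEnds e) }

/-- The configuration after `t` time units, started from `s₀`, with (integer) speedup factor `c`:
the algorithm makes one step in every time unit, and the evolver makes one step at the end of
every `c`-th time unit, its `m`-th step (`m = 0, 1, …`) being a swap along the edge `e m`. -/
noncomputable def run {T : SimpleGraph V} (hT : T.IsTree) (c : ℕ) (e : ℕ → T.edgeSet)
    (s₀ : State n V) : ℕ → State n V
  | 0 => s₀
  | t + 1 =>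
    if c ∣ t + 1 then evolverStep (e (t / c) : Sym2 V) (algStep hT (run hT c e s₀ t))
    else algStep hT (run hT c e s₀ t)

/-- The set of labels that reside at the vertex `v` in the hypothesis tree. -/
def labelsAt (s : State n V) (v : V) : Finset (Fin n) :=
  {l | s.hypLoc l = v}

/-- `E 0, E 1, …` is a uniform random evolver on `T`: the edges that it picks are independent
and uniformly distributed on the edge set of `T`. -/
structure IsRandomEvolver {V : Type*} {Ω : Type*} [MeasurableSpace Ω] (T : SimpleGraph V)
    (μ : Measure Ω) (E : ℕ → Ω → T.edgeSet) : Prop where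
  measurableSet_eq : ∀ m e, MeasurableSet {ω | E m ω = e}
  indep : iIndepFun (m := fun _ => ⊤) E μ
  uniform : ∀ m e, μ {ω | E m ω = e} = (Nat.card T.edgeSet : ENNReal)⁻¹

end EvolvingTree

namespace EvolvingTree

/-! Group time into rounds: two steps of the algorithm, then one swap. A query that is not answered
by null lowers the total distance `D` between true and hypothesized locations by 1, while a swap
raises `D` by at most 2 in expectation, so `D` alone has no useful drift. With `W` the number of
wrong labels, the potential `Φ = D - βW`, `β = 1/(k+1)`, does: per round, `Φ` minus the number of
null answers drifts down by at least `β` (`sum_potential_evolverStep_sub_le`,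
`potential_algStep_algStep_le`). As a swap changes `Φ` by at most 4, a small exponential of this
quantity contracts (`sum_exp_round_le`, `wordMean_exp_le`).

The pointer advances exactly at null answers, so `n` of them check every label. If that happens
within `m` rounds, `D` was at most `6m` beforehand. Hence over blocks of order `n` rounds the
exponential moment of `Φ` either contracts or is already `exp(O(n))`, and the initial configuration
is forgotten (`wordMean_exp_potential_le`). From there, a further window of order `n` rounds checks
every label, except with probability at most `3 exp(-n)`.

A checked label sits where it truly was when checked. So after such a window, all labels
hypothesized at `v`, up to the one being processed, were truly at `v` during it; there are at most 1
plus the number of swaps at `v`. That number has a bounded exponential moment, since the degree is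
at most `k` and there are `n - 1` edges. A union bound over the vertices concludes. -/

/-- The mean of `F` over all words of length `m` in the finite alphabet `α`. -/
noncomputable def wordMean {α : Type*} [Fintype α] : ℕ → (List α → ℝ) → ℝ
  | 0, F => F []
  | m + 1, F => (∑ a, wordMean m fun l => F (a :: l)) / Fintype.card α

/-! ### Averages over words of edges, a finite form of expectation. -/

section WordMean

variable {α : Type*} [Fintype α]

lemma wordMean_mono {m : ℕ} {F G : List α → ℝ} (h : ∀ l, l.length = m → F l ≤ G l) :
    wordMean m F ≤ wordMean m G := by
  induction m generalizing F G with
  | zero => exact h [] rfl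
  | succ m ih =>
    simp only [wordMean]
    gcongr with a
    exact ih fun l hl => h _ (by simp [hl])

lemma wordMean_const_mul (m : ℕ) (c : ℝ) (F : List α → ℝ) :
    wordMean m (fun l => c * F l) = c * wordMean m F := by
  induction m generalizing F with
  | zero => rfl
  | succ m ih => simp only [wordMean, ih, ← Finset.mul_sum, mul_div_assoc]

lemma wordMean_add (m : ℕ) (F G : List α → ℝ) :
    wordMean m (fun l => F l + G l) = wordMean m F + wordMean m G := by
  induction m generalizing F G with
  | zero => rfl
  | succ m ih => simp only [wordMean, ih, Finset.sum_add_distrib, add_div]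

lemma wordMean_const [Nonempty α] (m : ℕ) (c : ℝ) : wordMean m (fun _ : List α => c) = c := by
  induction m with
  | zero => rfl
  | succ m ih =>
    have : (Fintype.card α : ℝ) ≠ 0 := by simp
    simp only [wordMean, ih, Finset.sum_const, Finset.card_univ, nsmul_eq_mul]
    field_simp

lemma wordMean_le_of_forall_le [Nonempty α] {m : ℕ} {F : List α → ℝ} {c : ℝ}
    (h : ∀ l, l.length = m → F l ≤ c) : wordMean m F ≤ c :=
  (wordMean_mono h).trans_eq (wordMean_const m c)

lemma wordMean_sum {ι : Type*} (s : Finset ι) (m : ℕ) (F : ι → List α → ℝ) :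
    wordMean m (fun l => ∑ i ∈ s, F i l) = ∑ i ∈ s, wordMean m (F i) := by
  induction m generalizing F with
  | zero => rfl
  | succ m ih => simp only [wordMean, ih, Finset.sum_div]; rw [Finset.sum_comm]

/-- Plays the role of conditioning on the first `a` swaps. -/
lemma wordMean_append (a b : ℕ) (F : List α → ℝ) :
    wordMean (a + b) F = wordMean a fun l => wordMean b fun l' => F (l ++ l') := by
  induction a generalizing F with
  | zero => simp [wordMean]
  | succ a ih => rw [Nat.succ_add]; simp only [wordMean, ih, List.cons_append]

lemma wordMean_eq_sum (m : ℕ) (F : List α → ℝ) :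
    wordMean m F = ∑ x : Fin m → α, ((Fintype.card α : ℝ)⁻¹) ^ m * F (List.ofFn x) := by
  induction m generalizing F with
  | zero => simp [wordMean]
  | succ m ih =>
    rw [← (Fin.consEquiv fun _ : Fin (m + 1) => α).sum_comp, Fintype.sum_prod_type]
    simp only [wordMean, ih, Finset.sum_div]
    refine Finset.sum_congr rfl fun a _ => Finset.sum_congr rfl fun x _ => ?_
    simp only [Fin.consEquiv_apply, List.ofFn_succ, Fin.cons_zero, Fin.cons_succ]
    rw [pow_succ]
    ring

end WordMean

/-- The probability of an event determined by the first `m` edges of a random evolver is at most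
the proportion of words of length `m` in that event. -/
lemma IsRandomEvolver.measureReal_le_wordMean {V Ω : Type*} [MeasurableSpace Ω]
    {T : SimpleGraph V} [Fintype T.edgeSet] {μ : Measure Ω} [IsProbabilityMeasure μ]
    {E : ℕ → Ω → T.edgeSet} (hE : IsRandomEvolver T μ E) (m : ℕ) (F : List T.edgeSet → ℝ)
    (hF : ∀ l, 0 ≤ F l) {S : Set Ω}
    (hS : ∀ ω ∈ S, 1 ≤ F (List.ofFn fun i : Fin m => E i ω)) :
    μ.real S ≤ wordMean m F := by
  classical
  have hcyl (x : Fin m → T.edgeSet) :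
      μ.real {ω | (fun i : Fin m => E i ω) = x} = ((Fintype.card T.edgeSet : ℝ)⁻¹) ^ m := by
    -- Independence is indexed by ℕ, but `x` by `Fin m`; the value `Set.univ` is a default that is
    -- never reached for indices below `m`.
    have hset : {ω | (fun i : Fin m => E i ω) = x} =
        ⋂ i ∈ Finset.range m, E i ⁻¹' (if h : i < m then {x ⟨i, h⟩} else Set.univ) := by
      ext ω
      simp only [Set.mem_ofPred_eq, Set.mem_iInter, Finset.mem_range, Set.mem_preimage, funext_iff,
        Fin.forall_iff]
      refine forall_congr' fun i => forall_congr' fun hi => ?_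
      simp [hi]
    rw [hset, measureReal_def, hE.indep.measure_inter_preimage_eq_mul _
      (fun _ _ => MeasurableSpace.measurableSet_top)]
    rw [Finset.prod_congr rfl (g := fun _ => (Nat.card T.edgeSet : ENNReal)⁻¹)]
    · simp [Nat.card_eq_fintype_card]
    · intro i hi
      rw [dif_pos (Finset.mem_range.mp hi)]
      exact hE.uniform i _
  rw [wordMean_eq_sum]
  -- Only monotonicity and subadditivity are used, so `S` need not be measurable.
  calc μ.real S ≤ μ.real (⋃ x ∈ (Finset.univ.filter fun x : Fin m → T.edgeSet =>
        1 ≤ F (List.ofFn x)), {ω | (fun i : Fin m => E i ω) = x}) := by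
        refine measureReal_mono (fun ω hω => ?_) (measure_ne_top _ _)
        simpa using hS ω hω
    _ ≤ ∑ x ∈ (Finset.univ.filter fun x : Fin m → T.edgeSet => 1 ≤ F (List.ofFn x)),
        μ.real {ω | (fun i : Fin m => E i ω) = x} := measureReal_biUnion_finset_le _ _
    _ ≤ ∑ x ∈ (Finset.univ.filter fun x : Fin m → T.edgeSet => 1 ≤ F (List.ofFn x)),
        ((Fintype.card T.edgeSet : ℝ)⁻¹) ^ m * F (List.ofFn x) := by
        refine Finset.sum_le_sum fun x hx => ?_
        rw [hcyl]
        exact le_mul_of_one_le_right (by positivity) (Finset.mem_filter.mp hx).2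
    _ ≤ _ := Finset.sum_le_sum_of_subset_of_nonneg (Finset.filter_subset _ _)
        fun x _ _ => mul_nonneg (by positivity) (hF _)

/-! ### Distances in a tree. -/

section Distance

variable {V : Type*} {T : SimpleGraph V}

lemma dist_snd_add_one (hT : T.IsTree) {u w : V} (h : u ≠ w) {p : T.Walk u w}
    (hp : p.length = T.dist u w) : T.dist p.snd w + 1 = T.dist u w := by
  have hnil := SimpleGraph.Walk.not_nil_of_ne (p := p) h
  have h1 := SimpleGraph.Walk.length_tail_add_one hnil
  have h2 := SimpleGraph.dist_le p.tail
  have h3 : T.dist u w ≤ T.dist u p.snd + T.dist p.snd w := hT.connected.dist_triangle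
  have h4 := SimpleGraph.dist_eq_one_iff_adj.mpr (p.adj_snd hnil)
  omega

lemma exists_adj_dist_add_one (hT : T.IsTree) {u h : V} (hne : u ≠ h) :
    ∃ w, T.Adj u w ∧ T.dist w h + 1 = T.dist u h := by
  obtain ⟨p, hlen⟩ := hT.connected.exists_walk_length_eq_dist u h
  exact ⟨p.snd, p.adj_snd (SimpleGraph.Walk.not_nil_of_ne hne), dist_snd_add_one hT hne hlen⟩

lemma abs_dist_sub_dist_le_one (hT : T.IsTree) {a b : V} (hab : T.Adj a b) (h : V) :
    |(T.dist a h : ℝ) - T.dist b h| ≤ 1 := by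
  have h1 := SimpleGraph.dist_eq_one_iff_adj.mpr hab
  have h2 : T.dist a h ≤ T.dist a b + T.dist b h := hT.connected.dist_triangle
  have h3 : T.dist b h ≤ T.dist b a + T.dist a h := hT.connected.dist_triangle
  rw [SimpleGraph.dist_comm (u := b) (v := a)] at h3
  rw [h1] at h2 h3
  rw [abs_le]
  have h2' : (T.dist a h : ℝ) ≤ 1 + T.dist b h := mod_cast h2
  have h3' : (T.dist b h : ℝ) ≤ 1 + T.dist a h := mod_cast h3
  constructor <;> linarith

end Distance

/-! ### Effect of a query on distances and on wrong labels. -/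

section Algorithm

variable {n : ℕ} {V : Type*} [DecidableEq V] {T : SimpleGraph V}

/-- The number of null answers (`0` or `1`) that the next query of the algorithm gets. -/
def nullCount (s : State n V) : ℕ :=
  if s.hypLoc s.current = s.trueLoc s.current then 1 else 0

/-- The sum over all labels of the distance between true and hypothesized location. -/
noncomputable def totalDist (T : SimpleGraph V) (s : State n V) : ℕ :=
  ∑ l, T.dist (s.trueLoc l) (s.hypLoc l)

/-- The number of labels whose hypothesized location is wrong. -/
def wrongCount (s : State n V) : ℕ := ∑ l, if s.trueLoc l = s.hypLoc l then 0 else 1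

lemma exists_oracleTo_eq_some (hT : T.IsTree) {u w : V} (h : u ≠ w) :
    ∃ v, oracleTo hT w u = some v ∧ T.dist v w + 1 = T.dist u w := by
  refine ⟨_, if_neg h, ?_⟩
  obtain ⟨p, hp, hlen⟩ := hT.connected.exists_path_of_dist u w
  have hpath := (hT.existsUnique_path u w).choose_spec
  exact dist_snd_add_one hT h (hpath.2 p hp ▸ hlen)

lemma algStep_of_eq (hT : T.IsTree) {s : State n V}
    (h : s.hypLoc s.current = s.trueLoc s.current) :
    algStep hT s = { s with current := finRotate n s.current } := by
  simp [algStep, oracle, oracleTo, h]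

lemma exists_algStep_of_ne (hT : T.IsTree) {s : State n V}
    (h : s.hypLoc s.current ≠ s.trueLoc s.current) :
    ∃ v, T.dist (s.trueLoc s.current) v + 1
        = T.dist (s.trueLoc s.current) (s.hypLoc s.current) ∧
      algStep hT s = { s with hypLoc := Function.update s.hypLoc s.current v } := by
  obtain ⟨v, hv, hd⟩ := exists_oracleTo_eq_some hT h
  refine ⟨v, ?_, by simp only [algStep, oracle, hv]⟩
  rw [SimpleGraph.dist_comm, hd, SimpleGraph.dist_comm]

lemma trueLoc_algStep (hT : T.IsTree) (s : State n V) :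
    (algStep hT s).trueLoc = s.trueLoc := by
  by_cases h : s.hypLoc s.current = s.trueLoc s.current
  · rw [algStep_of_eq hT h]
  · obtain ⟨v, -, hs⟩ := exists_algStep_of_ne hT h
    rw [hs]

lemma hypLoc_algStep_of_ne_current (hT : T.IsTree) (s : State n V) {l : Fin n}
    (hl : l ≠ s.current) : (algStep hT s).hypLoc l = s.hypLoc l := by
  by_cases h : s.hypLoc s.current = s.trueLoc s.current
  · rw [algStep_of_eq hT h]
  · obtain ⟨v, -, hs⟩ := exists_algStep_of_ne hT h
    rw [hs]
    exact Function.update_of_ne hl _ _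

lemma dist_algStep_current_add_one (hT : T.IsTree) (s : State n V) :
    T.dist (s.trueLoc s.current) ((algStep hT s).hypLoc s.current) + 1
      = T.dist (s.trueLoc s.current) (s.hypLoc s.current) + nullCount s := by
  by_cases h : s.hypLoc s.current = s.trueLoc s.current
  · simp [algStep_of_eq hT h, nullCount, h]
  · obtain ⟨v, hv, hs⟩ := exists_algStep_of_ne hT h
    simp [hs, nullCount, h, hv]

lemma dist_algStep_le (hT : T.IsTree) (s : State n V) (l : Fin n) :
    T.dist (s.trueLoc l) ((algStep hT s).hypLoc l) ≤ T.dist (s.trueLoc l) (s.hypLoc l) := by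
  by_cases hl : l = s.current
  · subst hl
    have := dist_algStep_current_add_one hT s
    have : nullCount s ≤ 1 := by unfold nullCount; split <;> simp
    omega
  · rw [hypLoc_algStep_of_ne_current hT s hl]

lemma totalDist_algStep (hT : T.IsTree) (s : State n V) :
    totalDist T (algStep hT s) + 1 = totalDist T s + nullCount s := by
  unfold totalDist
  rw [← Finset.add_sum_erase _ _ (Finset.mem_univ s.current),
    ← Finset.add_sum_erase (a := s.current) _
      (fun l => T.dist (s.trueLoc l) (s.hypLoc l)) (Finset.mem_univ s.current),
    trueLoc_algStep]
  have h := dist_algStep_current_add_one hT s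
  rw [Finset.sum_congr rfl fun l hl => by
    rw [hypLoc_algStep_of_ne_current hT s (Finset.ne_of_mem_erase hl)]]
  omega

lemma wrongCount_le_algStep_add_one (hT : T.IsTree) (s : State n V) :
    wrongCount s ≤ wrongCount (algStep hT s) + 1 := by
  unfold wrongCount
  rw [← Finset.add_sum_erase _ _ (Finset.mem_univ s.current),
    ← Finset.add_sum_erase (a := s.current) _
      (fun l => if (algStep hT s).trueLoc l = (algStep hT s).hypLoc l then 0 else 1)
      (Finset.mem_univ s.current), trueLoc_algStep]
  rw [Finset.sum_congr (g := fun l => if s.trueLoc l = s.hypLoc l then 0 else 1)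
    (f := fun l => if s.trueLoc l = (algStep hT s).hypLoc l then 0 else 1) rfl
    fun l hl => by rw [hypLoc_algStep_of_ne_current hT s (Finset.ne_of_mem_erase hl)]]
  split <;> split <;> omega

lemma wrongCount_algStep_of_eq (hT : T.IsTree) {s : State n V}
    (h : s.hypLoc s.current = s.trueLoc s.current) :
    wrongCount (algStep hT s) = wrongCount s := by
  rw [algStep_of_eq hT h]; rfl

/-- Two successive steps of the algorithm correct at most one label: after a correction
the next query is answered by null. -/
lemma wrongCount_le_algStep_algStep_add_one (hT : T.IsTree) (s : State n V) :
    wrongCount s ≤ wrongCount (algStep hT (algStep hT s)) + 1 := by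
  by_cases h' : (algStep hT s).hypLoc (algStep hT s).current
      = (algStep hT s).trueLoc (algStep hT s).current
  · rw [wrongCount_algStep_of_eq hT h']
    exact wrongCount_le_algStep_add_one hT s
  -- A second query not answered by null means that the first step corrected nothing; only the
  -- second step can.
  · refine le_trans (le_of_eq ?_) (wrongCount_le_algStep_add_one hT _)
    by_cases h : s.hypLoc s.current = s.trueLoc s.current
    · rw [wrongCount_algStep_of_eq hT h]
    · obtain ⟨v, -, hs⟩ := exists_algStep_of_ne hT h
      rw [hs] at h' ⊢
      refine Finset.sum_congr rfl fun l _ => ?_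
      by_cases hl : l = s.current
      · subst hl
        rw [if_neg (Ne.symm h), if_neg (Ne.symm h')]
      · simp [Function.update_of_ne hl]

end Algorithm

/-! ### Effect of a swap on the potential. -/

section Evolver

variable {n : ℕ} {V : Type*} [DecidableEq V] {T : SimpleGraph V}

lemma swapEnds_mk (a b : V) : swapEnds s(a, b) = Equiv.swap a b := rfl

lemma swapEnds_apply_of_notMem {e : Sym2 V} {u : V} (h : u ∉ e) : swapEnds e u = u := by
  induction e with
  | _ a b =>
    rw [Sym2.mem_iff, not_or] at h
    exact Equiv.swap_apply_of_ne_of_ne h.1 h.2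

/-- Only the edges at `u` move the label that resides there, each to the opposite endpoint. -/
lemma sum_swapEnds_sub [Fintype V] [DecidableRel T.Adj] (g : V → ℝ) (u : V) :
    ∑ e : T.edgeSet, (g (swapEnds (e : Sym2 V) u) - g u)
      = ∑ w ∈ T.neighborFinset u, (g w - g u) := by
  rw [← Finset.sum_subtype T.edgeFinset (p := (· ∈ T.edgeSet)) (by simp)
    (fun e => g (swapEnds e u) - g u)]
  symm
  refine Finset.sum_of_injOn (fun w => s(u, w)) ?_ ?_ ?_ ?_
  · intro w _ w' _ h
    exact Sym2.congr_right.mp h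
  · intro w hw
    simpa using hw
  · intro e he hne
    rw [swapEnds_apply_of_notMem, sub_self]
    intro hu
    obtain ⟨w, rfl⟩ := Sym2.mem_iff_exists.mp hu
    exact hne ⟨w, by simpa using he, rfl⟩
  · intro w _
    rw [swapEnds_mk, Equiv.swap_apply_left]

lemma abs_sum_evolverStep_sub_le {e : Sym2 V} (he : e ∈ T.edgeSet) (s : State n V)
    (A : Finset (Fin n)) (f : V → V → ℝ) {c : ℝ} (hc : 0 ≤ c)
    (hf : ∀ a b h, T.Adj a b → |f a h - f b h| ≤ c) :
    |∑ l ∈ A, f ((evolverStep e s).trueLoc l) (s.hypLoc l)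
      - ∑ l ∈ A, f (s.trueLoc l) (s.hypLoc l)| ≤ 2 * c := by
  induction e with
  | _ a b =>
    have hab : T.Adj a b := he
    rw [← Finset.sum_sub_distrib]
    calc _ ≤ ∑ l ∈ A, |f ((evolverStep s(a, b) s).trueLoc l) (s.hypLoc l)
          - f (s.trueLoc l) (s.hypLoc l)| := Finset.abs_sum_le_sum_abs _ _
      _ ≤ ∑ l ∈ A, if l ∈ ({s.trueLoc.symm a, s.trueLoc.symm b} : Finset (Fin n)) then c else 0 := by
          refine Finset.sum_le_sum fun l _ => ?_
          change |f (Equiv.swap a b (s.trueLoc l)) _ - _| ≤ _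
          simp only [Finset.mem_insert, Finset.mem_singleton, Equiv.eq_symm_apply]
          by_cases ha : s.trueLoc l = a
          · rw [ha, Equiv.swap_apply_left, if_pos (Or.inl rfl)]
            exact hf _ _ _ hab.symm
          by_cases hb : s.trueLoc l = b
          · rw [hb, Equiv.swap_apply_right, if_pos (Or.inr rfl)]
            exact hf _ _ _ hab
          rw [Equiv.swap_apply_of_ne_of_ne ha hb, if_neg (by tauto), sub_self, abs_zero]
      _ ≤ 2 * c := by
          rw [← Finset.sum_filter, Finset.sum_const, nsmul_eq_mul]
          gcongr
          norm_cast
          calc _ ≤ ({s.trueLoc.symm a, s.trueLoc.symm b} : Finset (Fin n)).card :=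
                Finset.card_le_card fun l hl => (Finset.mem_filter.mp hl).2
            _ ≤ 2 := Finset.card_le_two

/-- The contribution to the potential of a label truly at `u` and hypothesized at `h`. -/
noncomputable def labelPotential (T : SimpleGraph V) (β : ℝ) (u h : V) : ℝ :=
  T.dist u h - β * if u = h then 0 else 1

/-- Total distance, minus `β` times the number of wrong labels. -/
noncomputable def potential (T : SimpleGraph V) (β : ℝ) (s : State n V) : ℝ :=
  ∑ l, labelPotential T β (s.trueLoc l) (s.hypLoc l)

lemma potential_eq (β : ℝ) (s : State n V) :
    potential T β s = totalDist T s - β * wrongCount s := by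
  simp only [potential, labelPotential, totalDist, wrongCount, Finset.sum_sub_distrib,
    ← Finset.mul_sum]
  push_cast
  rfl

lemma abs_labelPotential_sub_le (hT : T.IsTree) {β : ℝ} (hβ : 0 ≤ β) (hβ1 : β ≤ 1) {a b : V}
    (hab : T.Adj a b) (h : V) :
    |labelPotential T β a h - labelPotential T β b h| ≤ 2 := by
  have := abs_dist_sub_dist_le_one hT hab h
  rw [abs_le] at this ⊢
  unfold labelPotential
  split <;> split <;> constructor <;> linarith

lemma abs_potential_evolverStep_sub_le (hT : T.IsTree) {β : ℝ} (hβ : 0 ≤ β) (hβ1 : β ≤ 1)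
    {e : Sym2 V} (he : e ∈ T.edgeSet) (s : State n V) :
    |potential T β (evolverStep e s) - potential T β s| ≤ 4 :=
  (abs_sum_evolverStep_sub_le he s Finset.univ (labelPotential T β) (c := 2) (by norm_num)
    fun _ _ h hab => abs_labelPotential_sub_le hT hβ hβ1 hab h).trans (by norm_num)

/-- At `u = h` every neighbour is one farther and newly wrong, contributing at most `1 - β`.
Otherwise the neighbour towards `h` contributes at most `-1 + β` (it may be `h` itself) and each
other at most 1, in total `deg - 2 + β`; this is at most `(1 - β) deg` because `β (k + 1) ≤ 2`. -/
lemma sum_neighbor_labelPotential_sub_le [Fintype V] [DecidableRel T.Adj] (hT : T.IsTree) {k : ℕ}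
    (hk : T.maxDegree ≤ k) {β : ℝ} (hβ : 0 ≤ β) (hβk : β * (k + 1) ≤ 2) (u h : V) :
    ∑ w ∈ T.neighborFinset u, (labelPotential T β w h - labelPotential T β u h)
      ≤ (1 - β) * T.degree u := by
  have hdist (w) (hw : w ∈ T.neighborFinset u) : (T.dist w h : ℝ) - T.dist u h ≤ 1 :=
    (abs_le.mp (abs_dist_sub_dist_le_one hT ((T.mem_neighborFinset u w).mp hw).symm h)).2
  rw [← T.card_neighborFinset_eq_degree]
  by_cases hu : u = h
  · rw [mul_comm, ← nsmul_eq_mul]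
    refine Finset.sum_le_card_nsmul _ _ _ fun w hw => ?_
    have hwu : w ≠ h := hu ▸ ((T.mem_neighborFinset u w).mp hw).ne'
    have := hdist w hw
    simp only [labelPotential, if_pos hu, if_neg hwu]
    linarith
  · obtain ⟨w₀, hadj, hw₀⟩ := exists_adj_dist_add_one hT hu
    have hmem : w₀ ∈ T.neighborFinset u := (T.mem_neighborFinset u w₀).mpr hadj
    have hw₀' : (T.dist w₀ h : ℝ) + 1 = T.dist u h := mod_cast hw₀
    rw [← Finset.add_sum_erase _ _ hmem]
    have h1 : labelPotential T β w₀ h - labelPotential T β u h ≤ -1 + β := by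
      simp only [labelPotential, if_neg hu]
      split <;> linarith
    have h2 : ∑ w ∈ (T.neighborFinset u).erase w₀,
        (labelPotential T β w h - labelPotential T β u h)
        ≤ ((T.neighborFinset u).erase w₀).card • (1 : ℝ) := by
      refine Finset.sum_le_card_nsmul _ _ _ fun w hw => ?_
      -- If `h` were adjacent to `u`, then `dist u h = 1`, which forces `w₀ = h`, and `w₀` has been
      -- erased.
      have hwh : w ≠ h := by
        rintro rfl
        have := SimpleGraph.dist_eq_one_iff_adj.mpr
          ((T.mem_neighborFinset u w).mp (Finset.mem_of_mem_erase hw))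
        exact Finset.ne_of_mem_erase hw (hT.connected.dist_eq_zero_iff.mp (by omega)).symm
      have := hdist w (Finset.mem_of_mem_erase hw)
      simp only [labelPotential, if_neg hu, if_neg hwh]
      linarith
    have h3 : (((T.neighborFinset u).erase w₀).card : ℝ) + 1 = (T.neighborFinset u).card :=
      mod_cast Finset.card_erase_add_one hmem
    have h4 : ((T.neighborFinset u).card : ℝ) ≤ k := by
      rw [T.card_neighborFinset_eq_degree]
      exact_mod_cast (T.degree_le_maxDegree u).trans hk
    rw [nsmul_eq_mul, mul_one] at h2
    nlinarith

/-- The expected change of the potential in a step of the evolver is at most `2 - 2 β`. -/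
lemma sum_potential_evolverStep_sub_le [Fintype V] [DecidableRel T.Adj] (hT : T.IsTree) {k : ℕ}
    (hk : T.maxDegree ≤ k) {β : ℝ} (hβ : 0 ≤ β) (hβk : β * (k + 1) ≤ 2) (s : State n V) :
    ∑ e : T.edgeSet, (potential T β (evolverStep (e : Sym2 V) s) - potential T β s)
      ≤ (2 - 2 * β) * Fintype.card T.edgeSet := by
  simp only [potential, ← Finset.sum_sub_distrib]
  rw [Finset.sum_comm]
  calc _ ≤ ∑ l, (1 - β) * (T.degree (s.trueLoc l) : ℝ) := by
        refine Finset.sum_le_sum fun l _ => ?_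
        refine le_trans (le_of_eq ?_)
          (sum_neighbor_labelPotential_sub_le hT hk hβ hβk (s.trueLoc l) (s.hypLoc l))
        exact sum_swapEnds_sub (fun w => labelPotential T β w (s.hypLoc l)) (s.trueLoc l)
    -- The true labeling is a bijection, so the degrees seen by the labels add up to twice the
    -- number of edges.
    _ = (1 - β) * (∑ v, T.degree v : ℕ) := by
        rw [← Finset.mul_sum, s.trueLoc.sum_comp (fun v => (T.degree v : ℝ))]
        push_cast
        rfl
    _ = _ := by
        rw [T.sum_degrees_eq_twice_card_edges, SimpleGraph.edgeFinset_card]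
        push_cast
        ring

end Evolver

/-! ### Rounds and the exponential drift estimate. -/

section Round

variable {n : ℕ} {V : Type*} [DecidableEq V] {T : SimpleGraph V}

/-- Two time units: two steps of the algorithm, followed by a swap along `e`. -/
noncomputable def round (hT : T.IsTree) (s : State n V) (e : T.edgeSet) : State n V :=
  evolverStep (e : Sym2 V) (algStep hT (algStep hT s))

/-- The number of null answers in a round that starts from `s`. -/
noncomputable def roundNulls (hT : T.IsTree) (s : State n V) : ℕ :=
  nullCount s + nullCount (algStep hT s)

/-- The configuration after the rounds with the swaps listed in a word. -/
noncomputable def runWord (hT : T.IsTree) (s : State n V) (l : List T.edgeSet) : State n V :=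
  l.foldl (round hT) s

/-- The number of null answers in the rounds with the swaps listed in a word. -/
noncomputable def wordNulls (hT : T.IsTree) : State n V → List T.edgeSet → ℕ
  | _, [] => 0
  | s, e :: l => roundNulls hT s + wordNulls hT (round hT s e) l

lemma runWord_cons (hT : T.IsTree) (s : State n V) (e : T.edgeSet) (l : List T.edgeSet) :
    runWord hT s (e :: l) = runWord hT (round hT s e) l := rfl

lemma runWord_append (hT : T.IsTree) (s : State n V) (l l' : List T.edgeSet) :
    runWord hT s (l ++ l') = runWord hT (runWord hT s l) l' := List.foldl_append

lemma run_two_mul (hT : T.IsTree) (e : ℕ → T.edgeSet) (s : State n V) (m : ℕ) :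
    run hT 2 e s (2 * m) = runWord hT s (List.ofFn fun i : Fin m => e i) := by
  induction m with
  | zero => simp [run, runWord]
  | succ m ih =>
    rw [List.ofFn_succ_last, runWord_append]
    simp only [Fin.val_castSucc, Fin.val_last]
    rw [← ih, show 2 * (m + 1) = 2 * m + 1 + 1 by ring, run, run, if_pos (by omega),
      if_neg (by omega), show (2 * m + 1) / 2 = m by omega]
    rfl

lemma run_two_mul_add_one (hT : T.IsTree) (e : ℕ → T.edgeSet) (s : State n V) (m : ℕ) :
    run hT 2 e s (2 * m + 1) = algStep hT (run hT 2 e s (2 * m)) := by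
  rw [run, if_neg (by omega)]

lemma nullCount_le_one (s : State n V) : nullCount s ≤ 1 := by
  unfold nullCount; split <;> simp

/-- The loss is one `β`, not two, because two consecutive steps correct at most one label. Against
the swap's `2 - 2 * β` this leaves the drift `-β`; a loss of `2 * β` would leave none. -/
lemma potential_algStep_algStep_le (hT : T.IsTree) {β : ℝ} (hβ : 0 ≤ β) (s : State n V) :
    potential T β (algStep hT (algStep hT s)) ≤ potential T β s - 2 + roundNulls hT s + β := by
  have h1 : (totalDist T (algStep hT s) : ℝ) + 1 = totalDist T s + nullCount s :=
    mod_cast totalDist_algStep hT s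
  have h2 : (totalDist T (algStep hT (algStep hT s)) : ℝ) + 1
      = totalDist T (algStep hT s) + nullCount (algStep hT s) :=
    mod_cast totalDist_algStep hT (algStep hT s)
  have h3 : (wrongCount s : ℝ) ≤ wrongCount (algStep hT (algStep hT s)) + 1 :=
    mod_cast wrongCount_le_algStep_algStep_add_one hT s
  rw [potential_eq, potential_eq, roundNulls]
  push_cast
  nlinarith

lemma sum_exp_round_le [Fintype V] [DecidableRel T.Adj] (hT : T.IsTree) {k : ℕ}
    (hk : T.maxDegree ≤ k) {β θ : ℝ} (hβ : 0 ≤ β) (hβ1 : β ≤ 1) (hβk : β * (k + 1) ≤ 2)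
    (hθ : 32 * θ = β) (s : State n V) :
    ∑ e : T.edgeSet,
        Real.exp (θ * (potential T β (round hT s e) - potential T β s - roundNulls hT s))
      ≤ Real.exp (-(θ * β / 2)) * Fintype.card T.edgeSet := by
  set s' := algStep hT (algStep hT s) with hs'
  have hθ0 : 0 ≤ θ := by linarith
  have halg := potential_algStep_algStep_le hT hβ s
  have hstep (e : T.edgeSet) :
      Real.exp (θ * (potential T β (round hT s e) - potential T β s - roundNulls hT s))
        ≤ Real.exp (θ * (β - 2)) *
          (1 + θ * (potential T β (evolverStep (e : Sym2 V) s') - potential T β s')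
            + 16 * θ ^ 2) := by
    set d := potential T β (evolverStep (e : Sym2 V) s') - potential T β s' with hd
    have hd4 : |d| ≤ 4 := abs_potential_evolverStep_sub_le hT hβ hβ1 e.2 s'
    -- Here `exp x ≤ 1 + x + x²` for `|x| ≤ 1`, with `d² ≤ 16`.
    have hexp : Real.exp (θ * d) ≤ 1 + θ * d + 16 * θ ^ 2 := by
      have h1 : |θ * d| ≤ 1 := by
        rw [abs_mul, abs_of_nonneg hθ0]
        nlinarith [abs_nonneg d]
      have h2 := (abs_le.mp (Real.abs_exp_sub_one_sub_id_le h1)).2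
      have h3 : d ^ 2 ≤ 16 := by
        rw [← sq_abs]
        nlinarith [abs_nonneg d]
      nlinarith [sq_nonneg θ, mul_pow θ d 2]
    refine le_trans ?_ (mul_le_mul_of_nonneg_left hexp (Real.exp_nonneg _))
    rw [← Real.exp_add, Real.exp_le_exp, ← mul_add]
    refine mul_le_mul_of_nonneg_left ?_ hθ0
    have : potential T β (round hT s e) = d + potential T β s' := by rw [hd]; simp [round, hs']
    rw [this]
    linarith
  have hsum := sum_potential_evolverStep_sub_le hT hk hβ hβk s'
  calc _ ≤ ∑ e : T.edgeSet, Real.exp (θ * (β - 2)) *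
          (1 + θ * (potential T β (evolverStep (e : Sym2 V) s') - potential T β s')
            + 16 * θ ^ 2) := Finset.sum_le_sum fun e _ => hstep e
    _ = Real.exp (θ * (β - 2)) * ((1 + 16 * θ ^ 2) * Fintype.card T.edgeSet +
          θ * ∑ e : T.edgeSet,
            (potential T β (evolverStep (e : Sym2 V) s') - potential T β s')) := by
        rw [← Finset.mul_sum, Finset.sum_add_distrib, Finset.sum_add_distrib, ← Finset.mul_sum]
        simp only [Finset.sum_const, Finset.card_univ, nsmul_eq_mul]
        ring
    _ ≤ Real.exp (θ * (β - 2)) * ((1 + 16 * θ ^ 2) * Fintype.card T.edgeSet +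
          θ * ((2 - 2 * β) * Fintype.card T.edgeSet)) := by gcongr
    _ = Real.exp (θ * (β - 2)) * ((θ * (2 - 2 * β) + 16 * θ ^ 2) + 1)
          * Fintype.card T.edgeSet := by ring
    _ ≤ Real.exp (θ * (β - 2)) * Real.exp (θ * (2 - 2 * β) + 16 * θ ^ 2)
          * Fintype.card T.edgeSet := by gcongr; exact Real.add_one_le_exp _
    _ = Real.exp (-(θ * β / 2)) * Fintype.card T.edgeSet := by
        -- The exponents add up to `-θβ + 16θ²`; since `32θ = β`, the quadratic term consumes half
        -- of the drift.
        rw [← Real.exp_add]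
        congr 2
        rw [← hθ]
        ring

lemma wordMean_exp_le [Fintype V] [DecidableRel T.Adj] [Nonempty T.edgeSet] (hT : T.IsTree)
    {k : ℕ} (hk : T.maxDegree ≤ k) {β θ : ℝ} (hβ : 0 ≤ β) (hβ1 : β ≤ 1)
    (hβk : β * (k + 1) ≤ 2) (hθ : 32 * θ = β) (m : ℕ) (s : State n V) :
    wordMean m (fun l => Real.exp
        (θ * (potential T β (runWord hT s l) - potential T β s - wordNulls hT s l)))
      ≤ Real.exp (-(θ * β / 2)) ^ m := by
  induction m generalizing s with
  | zero => simp [wordMean, runWord, wordNulls]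
  | succ m ih =>
    have hcard : (0 : ℝ) < Fintype.card T.edgeSet := mod_cast Fintype.card_pos
    rw [wordMean, div_le_iff₀ hcard]
    calc _ = ∑ e : T.edgeSet,
          Real.exp (θ * (potential T β (round hT s e) - potential T β s - roundNulls hT s)) *
          wordMean m (fun l => Real.exp (θ * (potential T β (runWord hT (round hT s e) l)
            - potential T β (round hT s e) - wordNulls hT (round hT s e) l))) := by
          refine Finset.sum_congr rfl fun e _ => ?_
          rw [← wordMean_const_mul]
          congr 1
          ext l
          rw [← Real.exp_add, runWord_cons, wordNulls]
          congr 1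
          push_cast
          ring
      _ ≤ ∑ e : T.edgeSet,
          Real.exp (θ * (potential T β (round hT s e) - potential T β s - roundNulls hT s)) *
          Real.exp (-(θ * β / 2)) ^ m := by gcongr with e; exact ih _
      _ ≤ (Real.exp (-(θ * β / 2)) * Fintype.card T.edgeSet) * Real.exp (-(θ * β / 2)) ^ m := by
          rw [← Finset.sum_mul]
          gcongr
          exact sum_exp_round_le hT hk hβ hβ1 hβk hθ s
      _ = _ := by ring

end Round

/-! ### Windows of time in which every label is checked. -/

section Window

variable {n : ℕ} {V : Type*} [DecidableEq V] {T : SimpleGraph V}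

lemma val_finRotate_pow (c : Fin n) (j : ℕ) : ((finRotate n ^ j) c).val = (c.val + j) % n := by
  have := c.neZero
  induction j with
  | zero => simp [Nat.mod_eq_of_lt c.isLt]
  | succ j ih =>
    rw [pow_succ', Equiv.Perm.mul_apply, finRotate_apply, Fin.val_add, ih, Fin.val_one',
      ← Nat.add_mod, add_assoc]

lemma exists_finRotate_pow_eq (c l : Fin n) : ∃ j < n, (finRotate n ^ j) c = l := by
  refine ⟨(l.val + n - c.val) % n, Nat.mod_lt _ (Fin.pos l), Fin.ext ?_⟩
  have hc := c.isLt
  rw [val_finRotate_pow, Nat.add_mod_mod, show c.val + (l.val + n - c.val) = l.val + n by omega,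
    Nat.add_mod_right, Nat.mod_eq_of_lt l.isLt]

/-- Null answers count how far the pointer has advanced, so `n` of them amount to a full cycle. -/
lemma current_algStep (hT : T.IsTree) {c : Fin n} {N : ℕ} {s : State n V}
    (h : s.current = (finRotate n ^ N) c) :
    (algStep hT s).current = (finRotate n ^ (N + nullCount s)) c := by
  by_cases hs : s.hypLoc s.current = s.trueLoc s.current
  · rw [algStep_of_eq hT hs, show nullCount s = 1 from if_pos hs, pow_succ',
      Equiv.Perm.mul_apply, ← h]
  · obtain ⟨v, -, hv⟩ := exists_algStep_of_ne hT hs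
    rw [hv, show nullCount s = 0 from if_neg hs, add_zero, ← h]

lemma sum_dist_evolverStep (hT : T.IsTree) {e : Sym2 V} (he : e ∈ T.edgeSet) (s : State n V)
    (A : Finset (Fin n)) :
    ∑ l ∈ A, T.dist ((evolverStep e s).trueLoc l) (s.hypLoc l)
        ≤ ∑ l ∈ A, T.dist (s.trueLoc l) (s.hypLoc l) + 2 ∧
      ∑ l ∈ A, T.dist (s.trueLoc l) (s.hypLoc l)
        ≤ ∑ l ∈ A, T.dist ((evolverStep e s).trueLoc l) (s.hypLoc l) + 2 := by
  have h := abs_le.mp (abs_sum_evolverStep_sub_le he s A (fun a b => (T.dist a b : ℝ))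
    zero_le_one fun a b x hab => abs_dist_sub_dist_le_one hT hab x)
  constructor
  · have : (∑ l ∈ A, (T.dist ((evolverStep e s).trueLoc l) (s.hypLoc l) : ℝ))
      ≤ ∑ l ∈ A, (T.dist (s.trueLoc l) (s.hypLoc l) : ℝ) + 2 := by linarith [h.2]
    exact_mod_cast this
  · have : (∑ l ∈ A, (T.dist (s.trueLoc l) (s.hypLoc l) : ℝ))
      ≤ ∑ l ∈ A, (T.dist ((evolverStep e s).trueLoc l) (s.hypLoc l) : ℝ) + 2 := by linarith [h.1]
    exact_mod_cast this

lemma totalDist_round (hT : T.IsTree) (s : State n V) (e : T.edgeSet) :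
    totalDist T (round hT s e) ≤ totalDist T s + 2 ∧
      totalDist T s ≤ totalDist T (round hT s e) + 4 := by
  have h1 := totalDist_algStep hT s
  have h2 := totalDist_algStep hT (algStep hT s)
  have h3 := nullCount_le_one s
  have h4 := nullCount_le_one (algStep hT s)
  have h5 : totalDist T (round hT s e) ≤ totalDist T (algStep hT (algStep hT s)) + 2 ∧
      totalDist T (algStep hT (algStep hT s)) ≤ totalDist T (round hT s e) + 2 :=
    sum_dist_evolverStep hT e.2 (algStep hT (algStep hT s)) Finset.univ
  omega

lemma totalDist_runWord (hT : T.IsTree) (s : State n V) (l : List T.edgeSet) :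
    totalDist T (runWord hT s l) ≤ totalDist T s + 2 * l.length ∧
      totalDist T s ≤ totalDist T (runWord hT s l) + 4 * l.length := by
  induction l generalizing s with
  | nil => simp [runWord]
  | cons e l ih =>
    have := totalDist_round hT s e
    have := ih (round hT s e)
    rw [runWord_cons, List.length_cons]
    omega

/-- The first `N` labels in the cyclic order that starts with `c`. -/
def checkedLabels (c : Fin n) (N : ℕ) : Finset (Fin n) :=
  (Finset.range N).image fun j => (finRotate n ^ j) c

lemma checkedLabels_succ (c : Fin n) (N : ℕ) :
    checkedLabels c (N + 1) = insert ((finRotate n ^ N) c) (checkedLabels c N) := by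
  rw [checkedLabels, Finset.range_add_one, Finset.image_insert, checkedLabels]

lemma checkedLabels_eq_univ (c : Fin n) {N : ℕ} (h : n ≤ N) :
    checkedLabels c N = Finset.univ := by
  refine Finset.eq_univ_of_forall fun l => ?_
  obtain ⟨j, hj, rfl⟩ := exists_finRotate_pow_eq c l
  exact Finset.mem_image.mpr ⟨j, Finset.mem_range.mpr (hj.trans_le h), rfl⟩

/-- A label joins the checked set at a null answer, when its distance is 0. Hence only swaps can
raise the distance of the checked labels. -/
lemma sum_dist_checked_algStep_le (hT : T.IsTree) {c : Fin n} {N : ℕ} {s : State n V}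
    (h : s.current = (finRotate n ^ N) c) :
    ∑ l ∈ checkedLabels c (N + nullCount s),
        T.dist ((algStep hT s).trueLoc l) ((algStep hT s).hypLoc l)
      ≤ ∑ l ∈ checkedLabels c N, T.dist (s.trueLoc l) (s.hypLoc l) := by
  rw [trueLoc_algStep]
  refine (Finset.sum_le_sum fun l _ => dist_algStep_le hT s l).trans ?_
  by_cases hs : s.hypLoc s.current = s.trueLoc s.current
  · rw [show nullCount s = 1 from if_pos hs, checkedLabels_succ, ← h]
    by_cases hmem : s.current ∈ checkedLabels c N
    · rw [Finset.insert_eq_of_mem hmem]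
    · simp [Finset.sum_insert hmem, hs]
  · rw [show nullCount s = 0 from if_neg hs, add_zero]

lemma sum_dist_checked_runWord_le (hT : T.IsTree) {c : Fin n} {N : ℕ} {s : State n V}
    (h : s.current = (finRotate n ^ N) c) (w : List T.edgeSet) :
    ∑ l ∈ checkedLabels c (N + wordNulls hT s w),
        T.dist ((runWord hT s w).trueLoc l) ((runWord hT s w).hypLoc l)
      ≤ ∑ l ∈ checkedLabels c N, T.dist (s.trueLoc l) (s.hypLoc l) + 2 * w.length := by
  induction w generalizing N s with
  | nil => simp [wordNulls, runWord]
  | cons e w ih =>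
    have h1 := current_algStep hT h
    have h2 : (round hT s e).current = (finRotate n ^ (N + roundNulls hT s)) c := by
      rw [roundNulls, ← add_assoc]
      exact current_algStep hT h1
    have h3 := ih h2
    have h4 := sum_dist_checked_algStep_le hT h
    have h5 := sum_dist_checked_algStep_le hT h1
    rw [add_assoc] at h5
    have h6 := (sum_dist_evolverStep hT e.2 (algStep hT (algStep hT s))
      (checkedLabels c (N + roundNulls hT s))).1
    rw [wordNulls, ← add_assoc, runWord_cons, List.length_cons]
    refine h3.trans ?_
    change _ ≤ ∑ l ∈ checkedLabels c (N + roundNulls hT s), _ + 2 at h6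
    change ∑ l ∈ checkedLabels c (N + roundNulls hT s), _ ≤ _ at h5
    change ∑ l ∈ checkedLabels c (N + roundNulls hT s),
      T.dist ((evolverStep (e : Sym2 V) (algStep hT (algStep hT s))).trueLoc l)
        ((algStep hT (algStep hT s)).hypLoc l) + _ ≤ _
    omega

/-- If all labels are checked within a word, the distance before it was of the order of its
length at most. -/
lemma totalDist_le_of_le_wordNulls (hT : T.IsTree) {s : State n V} {w : List T.edgeSet}
    (h : n ≤ wordNulls hT s w) : totalDist T s ≤ 6 * w.length := by
  have h1 := sum_dist_checked_runWord_le hT (c := s.current) (N := 0) (s := s) (by simp) w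
  rw [checkedLabels_eq_univ _ (by omega)] at h1
  have h2 : totalDist T (runWord hT s w) ≤ 2 * w.length := by
    simpa [totalDist, checkedLabels] using h1
  -- A round lowers the distance by at most 4 (two queries, and 2 for the swap), whence `6 = 2 + 4`.
  have := (totalDist_runWord hT s w).2
  omega

/-- The number of swaps in a word that involve the vertex `v`. -/
def swapCount (v : V) (w : List T.edgeSet) : ℕ := w.countP fun e : T.edgeSet => v ∈ e.1

lemma swapCount_cons (v : V) (e : T.edgeSet) (w : List T.edgeSet) :
    swapCount v (e :: w) = swapCount v w + if v ∈ e.1 then 1 else 0 := by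
  simp [swapCount, List.countP_cons]

/-- `A` holds the labels truly at `v`, and among the first `N` labels in the cyclic order from
`c`, all those hypothesized at `v`, except possibly the label being processed. -/
structure Covers (c : Fin n) (v : V) (N : ℕ) (A : Finset (Fin n)) (s : State n V) : Prop where
  current_eq : s.current = (finRotate n ^ N) c
  true_mem : ∀ l, s.trueLoc l = v → l ∈ A
  hyp_mem : ∀ l ∈ checkedLabels c N, l ≠ s.current → s.hypLoc l = v → l ∈ A

/-- While being processed, a label may pass through `v` without ever being truly there, hence the
exception. When the pointer leaves it, hypothesis and truth agree, so if it is at `v` it is already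
in `A`. -/
lemma Covers.algStep (hT : T.IsTree) {c : Fin n} {v : V} {N : ℕ} {A : Finset (Fin n)}
    {s : State n V} (h : Covers c v N A s) :
    Covers c v (N + nullCount s) A (algStep hT s) := by
  refine ⟨current_algStep hT h.current_eq, by simpa only [trueLoc_algStep] using h.true_mem, ?_⟩
  by_cases hs : s.hypLoc s.current = s.trueLoc s.current
  · rw [show nullCount s = 1 from if_pos hs, checkedLabels_succ, ← h.current_eq,
      algStep_of_eq hT hs]
    intro l hl _ hlv
    by_cases hc : l = s.current
    · subst hc
      exact h.true_mem _ (hs ▸ hlv)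
    · exact h.hyp_mem l (Finset.mem_of_mem_insert_of_ne hl hc) hc hlv
  · rw [show nullCount s = 0 from if_neg hs, add_zero]
    intro l hl hc hlv
    have hcur : (EvolvingTree.algStep hT s).current = s.current := by
      obtain ⟨_, -, hv⟩ := exists_algStep_of_ne hT hs
      rw [hv]
    rw [hcur] at hc
    rw [hypLoc_algStep_of_ne_current hT s hc] at hlv
    exact h.hyp_mem l hl hc hlv

/-- A swap at `v` brings one label to `v`, which is added to `A`; other swaps leave the occupant of
`v` unchanged. -/
lemma Covers.evolverStep {c : Fin n} {v : V} {N : ℕ} {A : Finset (Fin n)} {s : State n V}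
    (h : Covers c v N A s) (e : Sym2 V) :
    ∃ A' : Finset (Fin n), A'.card ≤ A.card + (if v ∈ e then 1 else 0) ∧
      Covers c v N A' (evolverStep e s) := by
  by_cases hv : v ∈ e
  · refine ⟨insert ((EvolvingTree.evolverStep e s).trueLoc.symm v) A, ?_, h.current_eq, ?_, ?_⟩
    · rw [if_pos hv]
      exact Finset.card_insert_le _ _
    · intro l hl
      rw [← hl, Equiv.symm_apply_apply]
      exact Finset.mem_insert_self _ _
    · exact fun l hl hc hlv => Finset.mem_insert_of_mem (h.hyp_mem l hl hc hlv)
  · refine ⟨A, by simp, h.current_eq, fun l hl => h.true_mem l ?_, h.hyp_mem⟩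
    have hl' : swapEnds e (s.trueLoc l) = swapEnds e v := by
      rw [swapEnds_apply_of_notMem hv]
      exact hl
    exact (swapEnds e).injective hl'

lemma Covers.runWord (hT : T.IsTree) {c : Fin n} {v : V} {N : ℕ} {A : Finset (Fin n)}
    {s : State n V} (h : Covers c v N A s) (w : List T.edgeSet) :
    ∃ A' : Finset (Fin n), A'.card ≤ A.card + swapCount v w ∧
      Covers c v (N + wordNulls hT s w) A' (runWord hT s w) := by
  induction w generalizing N A s with
  | nil => exact ⟨A, Nat.le_add_right _ _, h⟩
  | cons e w ih =>
    obtain ⟨A₁, hA₁, h₁⟩ := ((h.algStep hT).algStep hT).evolverStep (e : Sym2 V)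
    obtain ⟨A₂, hA₂, h₂⟩ := ih h₁
    refine ⟨A₂, ?_, ?_⟩
    · rw [swapCount_cons]
      omega
    · rw [wordNulls, roundNulls, ← add_assoc, ← add_assoc]
      exact h₂

/-- If all labels are checked within a word, the labels hypothesized at `v` after it are,
up to one, labels that were truly at `v` at some time. -/
lemma card_labelsAt_le_of_le_wordNulls (hT : T.IsTree) {s : State n V} {w : List T.edgeSet}
    (h : n ≤ wordNulls hT s w) (v : V) :
    (labelsAt (runWord hT s w) v).card ≤ 2 + swapCount v w := by
  have h₀ : Covers s.current v 0 {s.trueLoc.symm v} s :=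
    ⟨by simp, fun l hl => by simp [← hl], by simp [checkedLabels]⟩
  obtain ⟨A, hA, hcov⟩ := h₀.runWord hT w
  have hsub : labelsAt (runWord hT s w) v ⊆ insert (runWord hT s w).current A := by
    intro l hl
    rw [Finset.mem_insert, or_iff_not_imp_left]
    intro hc
    refine hcov.hyp_mem l ?_ hc (Finset.mem_filter.mp hl).2
    rw [checkedLabels_eq_univ _ (by omega)]
    exact Finset.mem_univ l
  have h1 := (Finset.card_le_card hsub).trans (Finset.card_insert_le _ _)
  rw [Finset.card_singleton] at hA
  omega

lemma card_labelsAt_algStep_le (hT : T.IsTree) (s : State n V) (v : V) :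
    (labelsAt (algStep hT s) v).card ≤ (labelsAt s v).card + 1 := by
  refine (Finset.card_le_card (t := insert s.current (labelsAt s v)) fun l hl => ?_).trans
    (Finset.card_insert_le _ _)
  rw [Finset.mem_insert, or_iff_not_imp_left]
  intro hc
  have := (Finset.mem_filter.mp hl).2
  rw [hypLoc_algStep_of_ne_current hT s hc] at this
  exact Finset.mem_filter.mpr ⟨Finset.mem_univ l, this⟩

end Window

lemma totalDist_le_sq {n : ℕ} {V : Type*} {T : SimpleGraph V} (hT : T.IsTree)
    (s : State n V) : totalDist T s ≤ n ^ 2 := by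
  have : Fintype V := Fintype.ofEquiv _ s.trueLoc
  calc totalDist T s ≤ ∑ _l : Fin n, n := by
        refine Finset.sum_le_sum fun l _ => ?_
        obtain ⟨p, hp, hlen⟩ := hT.connected.exists_path_of_dist (s.trueLoc l) (s.hypLoc l)
        have := hp.length_lt
        rw [← Fintype.card_congr s.trueLoc, Fintype.card_fin] at this
        omega
    _ = n ^ 2 := by simp [sq]

/-! ### Exponential moments and tail bounds. -/

section Tail

variable {n : ℕ} {V : Type*} [DecidableEq V] {T : SimpleGraph V}

/-- Since `e < 3`, the exponential of an indicator is at most 1 plus twice the indicator, and `deg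
v` edges contain `v`. -/
lemma sum_exp_indicator_mem_le [Fintype V] [DecidableRel T.Adj] [Nonempty T.edgeSet] (v : V) :
    ∑ e : T.edgeSet, Real.exp ((if v ∈ e.1 then 1 else 0 : ℕ) : ℝ)
      ≤ Real.exp (2 * T.degree v / Fintype.card T.edgeSet) * Fintype.card T.edgeSet := by
  have hcard : (0 : ℝ) < Fintype.card T.edgeSet := mod_cast Fintype.card_pos
  have hterm (e : T.edgeSet) : Real.exp ((if v ∈ e.1 then 1 else 0 : ℕ) : ℝ)
      ≤ 1 + if v ∈ e.1 then 2 else 0 := by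
    split
    · have := Real.exp_one_lt_d9
      norm_num
      linarith
    · simp
  have hdeg : ∑ e : T.edgeSet, (if v ∈ e.1 then (2 : ℝ) else 0) = 2 * T.degree v := by
    rw [← Finset.sum_subtype T.edgeFinset (p := (· ∈ T.edgeSet)) (by simp)
      (fun e => if v ∈ e then (2 : ℝ) else 0), ← Finset.sum_filter, Finset.sum_const,
      ← T.incidenceFinset_eq_filter, T.card_incidenceFinset_eq_degree, nsmul_eq_mul, mul_comm]
  calc _ ≤ ∑ e : T.edgeSet, (1 + if v ∈ e.1 then (2 : ℝ) else 0) :=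
        Finset.sum_le_sum fun e _ => hterm e
    _ = (2 * T.degree v / Fintype.card T.edgeSet + 1) * Fintype.card T.edgeSet := by
        rw [Finset.sum_add_distrib, hdeg]
        simp only [Finset.sum_const, Finset.card_univ, nsmul_eq_mul]
        field_simp
        ring
    _ ≤ _ := by gcongr; exact Real.add_one_le_exp _

lemma wordMean_exp_swapCount_le [Fintype V] [DecidableRel T.Adj] [Nonempty T.edgeSet]
    (v : V) (m : ℕ) :
    wordMean m (fun w : List T.edgeSet => Real.exp (swapCount v w))
      ≤ Real.exp (2 * T.degree v / Fintype.card T.edgeSet) ^ m := by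
  induction m with
  | zero => simp [wordMean, swapCount]
  | succ m ih =>
    have hcard : (0 : ℝ) < Fintype.card T.edgeSet := mod_cast Fintype.card_pos
    rw [wordMean, div_le_iff₀ hcard]
    calc _ = ∑ e : T.edgeSet, Real.exp ((if v ∈ e.1 then 1 else 0 : ℕ) : ℝ) *
          wordMean m (fun w : List T.edgeSet => Real.exp (swapCount v w)) := by
          refine Finset.sum_congr rfl fun e _ => ?_
          rw [← wordMean_const_mul]
          congr 1
          ext w
          rw [← Real.exp_add, swapCount_cons]
          congr 1
          push_cast
          ring
      _ ≤ ∑ e : T.edgeSet, Real.exp ((if v ∈ e.1 then 1 else 0 : ℕ) : ℝ) *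
          Real.exp (2 * T.degree v / Fintype.card T.edgeSet) ^ m := by gcongr
      _ ≤ (Real.exp (2 * T.degree v / Fintype.card T.edgeSet) * Fintype.card T.edgeSet) *
          Real.exp (2 * T.degree v / Fintype.card T.edgeSet) ^ m := by
          rw [← Finset.sum_mul]
          gcongr
          exact sum_exp_indicator_mem_le v
      _ = _ := by ring

lemma potential_le_totalDist {β : ℝ} (hβ : 0 ≤ β) (s : State n V) :
    potential T β s ≤ totalDist T s := by
  rw [potential_eq]
  have : 0 ≤ β * wrongCount s := by positivity
  linarith

lemma neg_le_potential {β : ℝ} (hβ1 : β ≤ 1) (s : State n V) :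
    -(n : ℝ) ≤ potential T β s := by
  rw [potential_eq]
  have h1 : wrongCount s ≤ n := by
    calc wrongCount s ≤ ∑ _l : Fin n, 1 :=
          Finset.sum_le_sum fun l _ => by split <;> simp
      _ = n := by simp
  have h2 : (wrongCount s : ℝ) ≤ n := mod_cast h1
  have h3 : (0 : ℝ) ≤ totalDist T s := by positivity
  have h4 : (0 : ℝ) ≤ wrongCount s := by positivity
  nlinarith

/-- Dominates the indicator of the event that, within the window after the first `a` letters of
a word, some label is not checked or some vertex is swapped at least `x` times. -/
noncomputable def badWeight [Fintype V] (hT : T.IsTree) (s : State n V) (a : ℕ) (x : ℝ)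
    (w : List T.edgeSet) : ℝ :=
  (if wordNulls hT (runWord hT s (w.take a)) (w.drop a) < n then 1 else 0)
    + ∑ v : V, Real.exp (swapCount v (w.drop a) - x)

lemma badWeight_nonneg [Fintype V] (hT : T.IsTree) (s : State n V) (a : ℕ) (x : ℝ)
    (w : List T.edgeSet) : 0 ≤ badWeight hT s a x w := by
  unfold badWeight
  positivity

lemma one_le_badWeight [Fintype V] (hT : T.IsTree) (s : State n V) (a : ℕ) {x : ℝ}
    {w : List T.edgeSet} {v : V} (h : x + 2 ≤ (labelsAt (runWord hT s w) v).card) :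
    1 ≤ badWeight hT s a x w := by
  have hsum : ∀ u ∈ Finset.univ, 0 ≤ Real.exp (swapCount u (w.drop a) - x) :=
    fun u _ => by positivity
  unfold badWeight
  split_ifs with hN
  · linarith [Finset.sum_nonneg hsum]
  · rw [zero_add]
    refine le_trans ?_ (Finset.single_le_sum hsum (Finset.mem_univ v))
    refine Real.one_le_exp ?_
    have h1 := card_labelsAt_le_of_le_wordNulls hT (not_lt.mp hN) v
    rw [← runWord_append, List.take_append_drop] at h1
    have h2 : ((labelsAt (runWord hT s w) v).card : ℝ) ≤ 2 + swapCount v (w.drop a) :=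
      mod_cast h1
    linarith

variable [Fintype V] [DecidableRel T.Adj] [Nonempty T.edgeSet]

/-- In a block of suitable length proportional to `n`, the exponential moment of the potential
contracts up to an additive constant. -/
lemma wordMean_exp_potential_le_block (hT : T.IsTree) {k : ℕ} (hk : T.maxDegree ≤ k)
    {β θ : ℝ} (hβ : 0 ≤ β) (hβ1 : β ≤ 1) (hβk : β * (k + 1) ≤ 2) (hθ : 32 * θ = β)
    (hn : 0 < n) {m : ℕ} (hm : θ * n + n ≤ θ * β / 2 * m) (s : State n V) :
    wordMean m (fun w => Real.exp (θ * potential T β (runWord hT s w)))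
      ≤ 1 / 2 * Real.exp (θ * potential T β s) + Real.exp (8 * θ * m) := by
  have hθ0 : 0 ≤ θ := by linarith
  by_cases hD : totalDist T s ≤ 6 * m
  -- Small initial distance: it grows by at most 2 per round, so it ends below `6m + 2m`, whatever
  -- the swaps.
  · refine le_add_of_nonneg_of_le (by positivity) (wordMean_le_of_forall_le fun w hw => ?_)
    rw [Real.exp_le_exp]
    have h1 := (totalDist_runWord hT s w).1
    have h2 := potential_le_totalDist (T := T) hβ (runWord hT s w)
    have h3 : (totalDist T (runWord hT s w) : ℝ) ≤ 8 * m := by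
      rw [hw] at h1
      exact_mod_cast (show _ ≤ 8 * m by omega)
    nlinarith
  -- Large initial distance: no word of length `m` can check all labels, so null answers cost at
  -- most `n` and the drift wins; `hm` yields the factor `exp (-1) ≤ 1/2`.
  · refine le_add_of_le_of_nonneg ?_ (by positivity)
    calc _ ≤ wordMean m (fun w => Real.exp (θ * (potential T β s + n)) * Real.exp
          (θ * (potential T β (runWord hT s w) - potential T β s - wordNulls hT s w))) := by
          refine wordMean_mono fun w hw => ?_
          have hN : wordNulls hT s w ≤ n := by
            by_contra hcon
            have := totalDist_le_of_le_wordNulls hT (s := s) (w := w) (by omega)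
            omega
          have hN' : (wordNulls hT s w : ℝ) ≤ n := mod_cast hN
          rw [← Real.exp_add, Real.exp_le_exp, ← mul_add]
          refine mul_le_mul_of_nonneg_left ?_ hθ0
          linarith
      _ ≤ Real.exp (θ * (potential T β s + n)) * Real.exp (-(θ * β / 2)) ^ m := by
          rw [wordMean_const_mul]
          gcongr
          exact wordMean_exp_le hT hk hβ hβ1 hβk hθ m s
      _ ≤ Real.exp (-1) * Real.exp (θ * potential T β s) := by
          rw [← Real.exp_nat_mul, ← Real.exp_add, ← Real.exp_add, Real.exp_le_exp]
          have : (1 : ℝ) ≤ n := mod_cast hn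
          nlinarith
      _ ≤ _ := by
          gcongr
          rw [Real.exp_neg, ← one_div]
          gcongr
          have := Real.exp_one_gt_d9
          linarith

/-- The additive terms form a geometric series: `2 - 2 * (1/2)^j` is its `j`-th partial sum. -/
lemma wordMean_exp_potential_le_blocks (hT : T.IsTree) {k : ℕ} (hk : T.maxDegree ≤ k)
    {β θ : ℝ} (hβ : 0 ≤ β) (hβ1 : β ≤ 1) (hβk : β * (k + 1) ≤ 2) (hθ : 32 * θ = β)
    (hn : 0 < n) {m : ℕ} (hm : θ * n + n ≤ θ * β / 2 * m) (j : ℕ) (s : State n V) :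
    wordMean (j * m) (fun w => Real.exp (θ * potential T β (runWord hT s w)))
      ≤ (1 / 2) ^ j * Real.exp (θ * potential T β s)
        + (2 - 2 * (1 / 2) ^ j) * Real.exp (8 * θ * m) := by
  induction j generalizing s with
  | zero => simp [wordMean, runWord]
  | succ j ih =>
    rw [add_one_mul, add_comm, wordMean_append]
    simp only [runWord_append]
    calc _ ≤ wordMean m (fun w => (1 / 2) ^ j * Real.exp (θ * potential T β (runWord hT s w))
          + (2 - 2 * (1 / 2) ^ j) * Real.exp (8 * θ * m)) := wordMean_mono fun w _ => ih _
      _ = (1 / 2) ^ j * wordMean m (fun w => Real.exp (θ * potential T β (runWord hT s w)))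
          + (2 - 2 * (1 / 2) ^ j) * Real.exp (8 * θ * m) := by
          rw [wordMean_add, wordMean_const, wordMean_const_mul]
      _ ≤ (1 / 2) ^ j * (1 / 2 * Real.exp (θ * potential T β s) + Real.exp (8 * θ * m))
          + (2 - 2 * (1 / 2) ^ j) * Real.exp (8 * θ * m) := by
          gcongr
          exact wordMean_exp_potential_le_block hT hk hβ hβ1 hβk hθ hn hm s
      _ = _ := by rw [pow_succ]; ring

/-- After a long time, the exponential moment of the potential is bounded independently of the
initial configuration. -/
lemma wordMean_exp_potential_le (hT : T.IsTree) {k : ℕ} (hk : T.maxDegree ≤ k)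
    {β θ : ℝ} (hβ : 0 ≤ β) (hβ1 : β ≤ 1) (hβk : β * (k + 1) ≤ 2) (hθ : 32 * θ = β)
    (hn : 0 < n) {m : ℕ} (hm : θ * n + n ≤ θ * β / 2 * m) {a : ℕ} (ha : 2 * n ^ 2 * m ≤ a)
    (s : State n V) :
    wordMean a (fun w => Real.exp (θ * potential T β (runWord hT s w)))
      ≤ 3 * Real.exp (8 * θ * m) := by
  obtain ⟨r, rfl⟩ := Nat.exists_eq_add_of_le' ha
  rw [wordMean_append]
  refine wordMean_le_of_forall_le fun w _ => ?_
  simp only [runWord_append]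
  refine (wordMean_exp_potential_le_blocks hT hk hβ hβ1 hβk hθ hn hm _ _).trans ?_
  set s' := runWord hT s w
  have hθ0 : 0 ≤ θ := by linarith
  have hpot : potential T β s' ≤ (n : ℝ) ^ 2 :=
    (potential_le_totalDist hβ s').trans (mod_cast totalDist_le_sq hT s')
  -- The potential never exceeds `n²`, so `2n²` halvings absorb any starting point, as `e < 4`.
  have h1 : (1 / 2 : ℝ) ^ (2 * n ^ 2) * Real.exp (θ * potential T β s') ≤ 1 := by
    calc _ ≤ (1 / 4 : ℝ) ^ (n ^ 2) * Real.exp 1 ^ (n ^ 2) := by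
          rw [pow_mul, ← Real.exp_nat_mul]
          norm_num only
          refine mul_le_mul_of_nonneg_left (Real.exp_le_exp.mpr ?_) (by positivity)
          push_cast
          calc θ * potential T β s' ≤ θ * (n : ℝ) ^ 2 := by gcongr
            _ ≤ (n : ℝ) ^ 2 * 1 := by nlinarith [sq_nonneg (n : ℝ)]
      _ = (1 / 4 * Real.exp 1) ^ (n ^ 2) := by rw [mul_pow]
      _ ≤ 1 := by
          refine pow_le_one₀ (by positivity) ?_
          have := Real.exp_one_lt_d9
          linarith
  have h2 : 1 ≤ Real.exp (8 * θ * m) := Real.one_le_exp (by positivity)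
  have h3 : (0 : ℝ) ≤ (1 / 2) ^ (2 * n ^ 2) := by positivity
  nlinarith

/-- It is unlikely that the algorithm fails to check all labels within a window. -/
lemma wordMean_wordNulls_lt_le (hT : T.IsTree) {k : ℕ} (hk : T.maxDegree ≤ k)
    {β θ : ℝ} (hβ : 0 ≤ β) (hβ1 : β ≤ 1) (hβk : β * (k + 1) ≤ 2) (hθ : 32 * θ = β)
    (m : ℕ) (s : State n V) :
    wordMean m (fun w => if wordNulls hT s w < n then (1 : ℝ) else 0)
      ≤ Real.exp (2 * θ * n - θ * β / 2 * m) * Real.exp (θ * potential T β s) := by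
  have hθ0 : 0 ≤ θ := by linarith
  calc _ ≤ wordMean m (fun w => Real.exp (θ * (potential T β s + 2 * n)) * Real.exp
        (θ * (potential T β (runWord hT s w) - potential T β s - wordNulls hT s w))) := by
        refine wordMean_mono fun w _ => ?_
        split_ifs with h
        · rw [← Real.exp_add, ← mul_add]
          refine Real.one_le_exp (mul_nonneg hθ0 ?_)
          have h1 := neg_le_potential (T := T) hβ1 (runWord hT s w)
          have h2 : (wordNulls hT s w : ℝ) ≤ n := mod_cast h.le
          linarith
        · positivity
    _ ≤ Real.exp (θ * (potential T β s + 2 * n)) * Real.exp (-(θ * β / 2)) ^ m := by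
        rw [wordMean_const_mul]
        gcongr
        exact wordMean_exp_le hT hk hβ hβ1 hβk hθ m s
    _ = _ := by
        rw [← Real.exp_nat_mul, ← Real.exp_add, ← Real.exp_add]
        congr 1
        ring

lemma wordMean_badWeight_le (hT : T.IsTree) {k : ℕ} (hk : T.maxDegree ≤ k)
    {β θ : ℝ} (hβ : 0 ≤ β) (hβ1 : β ≤ 1) (hβk : β * (k + 1) ≤ 2) (hθ : 32 * θ = β)
    (hn : 2 ≤ n) {m : ℕ} (hm : θ * n + n ≤ θ * β / 2 * m) {a : ℕ} (ha : 2 * n ^ 2 * m ≤ a)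
    {q : ℕ} (hq : 2 * θ * n + 8 * θ * m + n ≤ θ * β / 2 * (q * n : ℕ)) (x : ℝ)
    (s : State n V) :
    wordMean (a + q * n) (badWeight hT s a x)
      ≤ 3 * Real.exp (-n) + n * Real.exp (4 * k * q - x) := by
  have hcardV : Fintype.card V = n := by
    rw [← Fintype.card_congr s.trueLoc, Fintype.card_fin]
  have hcardE : Fintype.card T.edgeSet + 1 = n := by
    rw [← SimpleGraph.edgeFinset_card, hT.card_edgeFinset, hcardV]
  have hswap (v : V) : wordMean (q * n) (fun w : List T.edgeSet => Real.exp (swapCount v w - x))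
      ≤ Real.exp (4 * k * q - x) := by
    have h1 : (fun w : List T.edgeSet => Real.exp (swapCount v w - x))
        = fun w => Real.exp (-x) * Real.exp (swapCount v w) := by
      ext w
      rw [← Real.exp_add]
      ring_nf
    rw [h1, wordMean_const_mul]
    refine (mul_le_mul_of_nonneg_left (wordMean_exp_swapCount_le v _) (by positivity)).trans ?_
    rw [← Real.exp_nat_mul, ← Real.exp_add, Real.exp_le_exp]
    have hE : (0 : ℝ) < Fintype.card T.edgeSet := mod_cast Fintype.card_pos
    -- A tree has `n - 1` edges, and `n ≤ 2 (n - 1)` for `n ≥ 2`.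
    have hnE : (n : ℝ) ≤ 2 * Fintype.card T.edgeSet := mod_cast (by omega)
    have hd : (T.degree v : ℝ) ≤ k := mod_cast (T.degree_le_maxDegree v).trans hk
    have h2 : ((q * n : ℕ) : ℝ) * (2 * T.degree v / Fintype.card T.edgeSet) ≤ 4 * k * q := by
      rw [← mul_div_assoc, div_le_iff₀ hE]
      push_cast
      calc (q : ℝ) * n * (2 * T.degree v) ≤ q * (2 * Fintype.card T.edgeSet) * (2 * k) := by
            gcongr
        _ = _ := by ring
    linarith
  rw [wordMean_append]
  calc _ ≤ wordMean a (fun w => Real.exp (2 * θ * n - θ * β / 2 * (q * n : ℕ))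
        * Real.exp (θ * potential T β (runWord hT s w)) + n * Real.exp (4 * k * q - x)) := by
        refine wordMean_mono fun w hw => ?_
        simp only [badWeight, List.take_left' hw, List.drop_left' hw]
        rw [wordMean_add, wordMean_sum]
        refine add_le_add (wordMean_wordNulls_lt_le hT hk hβ hβ1 hβk hθ _ _) ?_
        refine (Finset.sum_le_sum fun v _ => hswap v).trans_eq ?_
        rw [Finset.sum_const, Finset.card_univ, hcardV, nsmul_eq_mul]
    _ = Real.exp (2 * θ * n - θ * β / 2 * (q * n : ℕ))
        * wordMean a (fun w => Real.exp (θ * potential T β (runWord hT s w)))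
        + n * Real.exp (4 * k * q - x) := by
        rw [wordMean_add, wordMean_const, wordMean_const_mul]
    _ ≤ Real.exp (2 * θ * n - θ * β / 2 * (q * n : ℕ)) * (3 * Real.exp (8 * θ * m))
        + n * Real.exp (4 * k * q - x) := by
        gcongr
        exact wordMean_exp_potential_le hT hk hβ hβ1 hβk hθ (by omega) hm ha s
    _ ≤ _ := by
        rw [mul_left_comm, ← Real.exp_add]
        gcongr
        linarith

end Tail

/-- Used with `y = √n`: both summands are small multiples of `exp (-y)`, with total coefficient `4 *
exp (-2) ≤ 1`. -/
lemma exp_tail_le {y Q C : ℝ} (hQ : 0 ≤ Q) (hC : C = Q + 10) (hy : C ≤ y) :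
    3 * Real.exp (-y ^ 2) + y ^ 2 * Real.exp (Q - (C * y - 3)) ≤ Real.exp (-1 * y) := by
  have hy10 : 10 ≤ y := by linarith
  have h1 : Real.exp (-y ^ 2) ≤ Real.exp (-1 * y) * Real.exp (-2) := by
    rw [← Real.exp_add, Real.exp_le_exp]
    nlinarith
  have h2 : y ^ 2 * Real.exp (Q - (C * y - 3)) ≤ Real.exp (-1 * y) * Real.exp (-2) := by
    have hy2 : y ^ 2 ≤ Real.exp (2 * y) := by
      have : y ≤ Real.exp y := by linarith [Real.add_one_le_exp y]
      rw [two_mul, Real.exp_add, sq]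
      gcongr
    calc _ ≤ Real.exp (2 * y) * Real.exp (Q - (C * y - 3)) := by gcongr
      _ ≤ _ := by
        rw [← Real.exp_add, ← Real.exp_add, Real.exp_le_exp]
        nlinarith
  have h3 : Real.exp (-2) * 4 ≤ 1 := by
    have h : Real.exp (-2) = (Real.exp 1 * Real.exp 1)⁻¹ := by
      rw [← Real.exp_add, ← Real.exp_neg]
      norm_num
    have he := Real.exp_one_gt_d9
    rw [h, inv_mul_le_iff₀ (by positivity)]
    nlinarith
  nlinarith [Real.exp_pos (-1 * y)]

end EvolvingTree

open EvolvingTree in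
theorem mainTheorem5 (k : ℕ) :
    ∃ C c : ℝ, 0 < C ∧ 0 < c ∧ ∃ t₀ : ℕ → ℕ,
      ∀ (n : ℕ) [NeZero n] (V : Type*) [Fintype V] [DecidableEq V]
        (T : SimpleGraph V) [DecidableRel T.Adj] (hT : T.IsTree), T.maxDegree ≤ k →
      ∀ (M₀ : Fin n ≃ V) (H₀ : Fin n → V)
        (Ω : Type*) [MeasurableSpace Ω] (μ : Measure Ω) [IsProbabilityMeasure μ]
        (E : ℕ → Ω → T.edgeSet), IsRandomEvolver T μ E →
      ∀ t : ℕ, t₀ n ≤ t →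
        1 - Real.exp (-c * √(n : ℝ)) ≤
          μ.real {ω | ∀ v : V,
            ((labelsAt (run hT 2 (fun m => E m ω) ⟨M₀, H₀, 0⟩ t) v).card : ℝ) ≤ C * √(n : ℝ)} := by
  -- With `β = 1/K` and `θ = 1/(32K)`, `p` and `q` turn the block condition `hm` (for `m = p * n`)
  -- and the window condition `hq` into equalities.
  set K : ℕ := k + 1 with hK
  set p : ℕ := 2 * K * (1 + 32 * K) with hp
  set q : ℕ := 2 * K * (2 + 8 * p + 32 * K) with hq
  set Q : ℝ := 4 * k * q with hQ
  have hQ0 : 0 ≤ Q := by positivity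
  refine ⟨Q + 10, 1, by positivity, one_pos,
    fun n => 2 * (2 * n ^ 2 * (p * n) + q * n), ?_⟩
  intro n _ V _ _ T _ hT hk M₀ H₀ Ω _ μ _ E hE t ht
  set s₀ : State n V := ⟨M₀, H₀, 0⟩
  set good := {ω | ∀ v : V, ((labelsAt (run hT 2 (fun m => E m ω) s₀ t) v).card : ℝ)
    ≤ (Q + 10) * √(n : ℝ)} with hgood
  have hsqrt : √(n : ℝ) * √(n : ℝ) = n := Real.mul_self_sqrt (by positivity)
  -- For small `n` the bound is trivial: a vertex holds at most `n = √n * √n` labels.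
  rcases le_total √(n : ℝ) (Q + 10) with hsmall | hlarge
  · have huniv : good = Set.univ := by
      refine Set.eq_univ_of_forall fun ω v => ?_
      have h1 : ((labelsAt (run hT 2 (fun m => E m ω) s₀ t) v).card : ℝ) ≤ n := by
        exact_mod_cast (Finset.card_le_univ _).trans_eq (Fintype.card_fin n)
      refine h1.trans ?_
      nlinarith [Real.sqrt_nonneg (n : ℝ)]
    rw [huniv, probReal_univ]
    linarith [Real.exp_pos (-1 * √(n : ℝ))]
  have hn : 2 ≤ n := by
    have : (2 : ℝ) ≤ n := by nlinarith
    exact_mod_cast this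
  obtain ⟨ω₀⟩ : Nonempty Ω := μ.nonempty_of_neZero
  have : Nonempty T.edgeSet := ⟨E 0 ω₀⟩
  obtain ⟨a, ha⟩ : ∃ a, t / 2 = a + q * n :=
    Nat.exists_eq_add_of_le' (by have := ht; dsimp only at this; omega)
  have ha' : 2 * n ^ 2 * (p * n) ≤ a := by dsimp only at ht; omega
  have hKpos : (0 : ℝ) < K := by positivity
  have hbad : μ.real goodᶜ ≤ wordMean (a + q * n)
      -- The 3 covers the 2 in `one_le_badWeight` and one more label when `t` is odd, that is, half
      -- a round past `2 * (t / 2)`.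
      (badWeight hT s₀ a ((Q + 10) * √(n : ℝ) - 3)) := by
    refine hE.measureReal_le_wordMean _ _ (badWeight_nonneg hT s₀ a _) fun ω hω => ?_
    simp only [hgood, Set.mem_compl_iff, Set.mem_ofPred_eq, not_forall, not_le] at hω
    obtain ⟨v, hv⟩ := hω
    refine one_le_badWeight hT s₀ a (v := v) ?_
    rw [← run_two_mul hT (fun m => E m ω), ← ha]
    have hcard : (labelsAt (run hT 2 (fun m => E m ω) s₀ t) v).card
        ≤ (labelsAt (run hT 2 (fun m => E m ω) s₀ (2 * (t / 2))) v).card + 1 := by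
      rcases Nat.mod_two_eq_zero_or_one t with h | h
      · rw [show 2 * (t / 2) = t by omega]
        omega
      · have := card_labelsAt_algStep_le hT (run hT 2 (fun m => E m ω) s₀ (2 * (t / 2))) v
        rwa [← run_two_mul_add_one, show 2 * (t / 2) + 1 = t by omega] at this
    have hcard' : ((labelsAt (run hT 2 (fun m => E m ω) s₀ t) v).card : ℝ)
        ≤ (labelsAt (run hT 2 (fun m => E m ω) s₀ (2 * (t / 2))) v).card + 1 := mod_cast hcard
    linarith
  have hmean := wordMean_badWeight_le hT hk (β := 1 / K) (θ := 1 / (32 * K)) (by positivity)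
    (by rw [div_le_one hKpos]; exact_mod_cast Nat.succ_le_succ (Nat.zero_le k))
    (by rw [hK]; push_cast; rw [one_div_mul_cancel (by positivity)]; norm_num)
    (by field_simp) hn (m := p * n)
    (by rw [hp]; push_cast; apply le_of_eq; field_simp) ha' (q := q)
    (by rw [hq]; push_cast; apply le_of_eq; field_simp)
    ((Q + 10) * √(n : ℝ) - 3) s₀
  have htail := exp_tail_le hQ0 rfl hlarge
  rw [Real.sq_sqrt (by positivity)] at htail
  -- Subadditivity suffices, so measurability of `good` is not needed.
  have htotal : 1 ≤ μ.real good + μ.real goodᶜ := by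
    have := measureReal_union_le (μ := μ) good goodᶜ
    rwa [Set.union_compl_self, probReal_univ] at this
  linarith
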